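/- **Theorem 4.2.** An F-algebra is a (not necessarily unital) associative complex algebra whose topology is induced by a complete translation-invariant metric and whose addition, scalar multiplication and multiplication are (jointly) continuous. "Subalgebra" means a linear subspace closed under multiplication (not required to contain a unit). A family $(g_i)_{i\in I}$ in a commutative algebra *freely generates* the subalgebra $A$ if $A$ is the smallest subalgebra containing all $g_i$ and $P((g_i)_i)\neq 0$ for every non-zero complex polynomial $P$ in commuting variables indexed by $I$ with zero constant term. Let $X$ be a separable commutative F-algebra that has a dense subalgebra freely generated by some non-empty set, and let $T:X\to X$ be a continuous linear operator. Suppose there exist a function $E:\mathbb{C}\to X$ and an entire function $\phi:\mathbb{C}\to\mathbb{C}$ such that (a) $TE(\lambda)=\phi(\lambda)E(\lambda)$ for each $\lambda\in\mathbb{C}$; (b) $E(\lambda)E(\mu)=E(\lambda+\mu)$ for all $\lambda,\mu\in\mathbb{C}$; (c) for each $\Lambda\subset\mathbb{C}$ having an accumulation point in $\mathbb{C}$, the linear span of $\{E(\lambda):\lambda\in\Lambda\}$ is dense in $X$; (d) $|\phi(0)|=1$, $\phi''(0)\phi(0)\neq\phi'(0)^2$ and $\phi'(0)\neq 0$. Then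 there is a dense $G_\delta$ subset $G$ of $X^{\mathbb{N}}$ (with the product topology) such that every $f=(f_n)_{n}\in G$ freely generates a dense subalgebra of $X$ each of whose non-zero elements $g$ is a hypercyclic vector for $T$, that is, the orbit $\{T^n g: n=0,1,2,\dots\}$ is dense in $X$. -/

import Mathlib

open Topology Filter

/-- Value at `f` of the polynomial `P` in an algebra `X` that need not have a unit.
The polynomial is evaluated in the unitization `ℂ ⊕ X`; the `ℂ`-component of the result is the
constant term of `P`, so for `P` without constant term the value lies in `X`, and this is it. -/
noncomputable def polyValue {X : Type*} [NonUnitalCommRing X] [Module ℂ X] [IsScalarTower ℂ X X]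
    [SMulCommClass ℂ X X] {ι : Type*} (f : ι → X) (P : MvPolynomial ι ℂ) : X :=
  (MvPolynomial.aeval (fun i => (f i : Unitization ℂ X)) P).snd

theorem aeval_unitization_fst {X : Type*} [NonUnitalCommRing X] [Module ℂ X]
    [IsScalarTower ℂ X X] [SMulCommClass ℂ X X] {ι : Type*} (f : ι → X) (P : MvPolynomial ι ℂ) :
    (MvPolynomial.aeval (fun i => (f i : Unitization ℂ X)) P).fst
      = MvPolynomial.constantCoeff P := by
  induction P using MvPolynomial.induction_on with
  | C a => simp [Unitization.algebraMap_eq_inl]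
  | add p q hp hq => simp [hp, hq]
  | mul_X p i hp => simp

/-- A family is free if no non-zero polynomial without constant term vanishes at it. -/
def IsFreeFamily {X : Type*} [NonUnitalCommRing X] [Module ℂ X] [IsScalarTower ℂ X X]
    [SMulCommClass ℂ X X] {ι : Type*} (f : ι → X) : Prop :=
  ∀ P : MvPolynomial ι ℂ, MvPolynomial.constantCoeff P = 0 → polyValue f P = 0 → P = 0

/-- `f` freely generates the subalgebra `A`: the family `f` is free, and `A` is the smallest
subalgebra containing it, i.e. the set of values at `f` of polynomials without constant term. -/
def FreelyGenerates {X : Type*} [NonUnitalCommRing X] [Module ℂ X] [IsScalarTower ℂ X X]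
    [SMulCommClass ℂ X X] {ι : Type*} (f : ι → X) (A : NonUnitalSubalgebra ℂ X) : Prop :=
  IsFreeFamily f ∧ NonUnitalAlgebra.adjoin ℂ (Set.range f) = A

/-- `x` is a hypercyclic vector for the operator `T`: its orbit is dense. -/
def IsHypercyclicVector {X : Type*} [AddCommGroup X] [Module ℂ X] [TopologicalSpace X]
    (T : X →L[ℂ] X) (x : X) : Prop :=
  Dense (Set.range fun n : ℕ => (T ^ n) x)

/-! The hypotheses on `φ` at 0 give a direction `v` in which `H s = log ‖φ (s v)‖` is strictly
increasing and strictly convex near 0, with `H 0 = 0`. Put `e s = E (s v)` and `χ s = φ (s v)`. By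
density `E 0` is a unit, so `X` is unital.

Given a degree `d` and a target `u = ∑ c_s e(s)` with `0 < s < δ`, let `B_n = ∑ γ_s ρ_s ^ n e(s/d)`,
where `γ_s ^ d = c_s` and `ρ_s ^ d = 1/χ(s)`. Then `B_n → 0`. In `T ^ n (B_n ^ d)` the pure powers
add up to `u`, while the mixed terms decay by strict convexity. Lower powers decay too, the missing
factors acting as mass at 0, and factors with negative frequencies decay by monotonicity. Hence, if
`P` has degree `d` and no constant term, `T ^ n P(A + t B_n) → P_d(t) u` with `P_d` the top
homogeneous part (`exists_steering_sequence`).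

Normalizing `P_d(t) = 1` and bounding the coefficients leaves compact sets of polynomials, so
countably many dense open conditions suffice for Baire's theorem. Freeness is then automatic,
because 0 is not hypercyclic. -/

/-! ### A direction of convexity and growth -/

theorem exists_re_mul_pos_and_re_sq_mul_pos {a b : ℂ} (ha : a ≠ 0) (hb : b ≠ 0) :
    ∃ v : ℂ, 0 < (v * a).re ∧ 0 < (v ^ 2 * b).re := by
  obtain ⟨y, hy⟩ := IsAlgClosed.exists_pow_nat_eq (a ^ 2 / b) (n := 2) (by norm_num)
  have hy0 : y ≠ 0 := by
    rintro rfl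
    have : a ^ 2 / b ≠ 0 := by positivity
    exact this (by simpa using hy.symm)
  -- `v = ζ * y / a` turns the two conditions into `0 < Re (ζ y)` and `0 < Re (ζ ^ 2)`
  have key : ∀ ζ : ℂ, 0 < (ζ * y).re → 0 < (ζ ^ 2).re →
      ∃ v : ℂ, 0 < (v * a).re ∧ 0 < (v ^ 2 * b).re := by
    intro ζ h1 h2
    refine ⟨ζ * y / a, ?_, ?_⟩
    · rwa [div_mul_cancel₀ _ ha]
    · have : (ζ * y / a) ^ 2 * b = ζ ^ 2 := by
        rw [div_pow, mul_pow, hy]; field_simp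
      rwa [this]
  have hre : ∀ x z : ℝ, ((⟨x, z⟩ : ℂ) ^ 2).re = x ^ 2 - z ^ 2 := by
    intro x z; simp [pow_two]
  -- `ζ = ±1` works unless `y` is purely imaginary; then `2 ± i` tilts it while staying in the
  -- sector `Re (ζ ^ 2) > 0`.
  rcases lt_trichotomy y.re 0 with h | h | h
  · refine key (-1) (by simpa using h) (by norm_num)
  · have him : y.im ≠ 0 := fun h' => hy0 (Complex.ext h h')
    rcases lt_or_gt_of_ne him with h' | h'
    · refine key ⟨2, 1⟩ ?_ (by rw [hre]; norm_num)
      simp [h, h']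
    · refine key ⟨2, -1⟩ ?_ (by rw [hre]; norm_num)
      simp [h, h']
  · exact key 1 (by simpa using h) (by norm_num)

/-- `log ‖φ‖` is the real part of a local logarithm of `φ`; dividing by `c` moves the value at `s`
to 1, away from the branch cut. -/
theorem hasDerivAt_log_norm_comp_ofReal_mul {φ : ℂ → ℂ} (hφ : Differentiable ℂ φ) (v : ℂ) {s : ℝ}
    (hs : φ (s * v) ≠ 0) :
    HasDerivAt (fun x : ℝ => Real.log ‖φ (x * v)‖) (v * logDeriv φ (s * v)).re s := by
  set c := φ (s * v) with hc
  have h1 : HasDerivAt (fun x : ℝ => (x : ℂ) * v) v s := by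
    simpa using (Complex.ofRealCLM.hasDerivAt (x := s)).mul_const v
  have h2 : HasDerivAt (fun x : ℝ => φ (x * v) / c) (deriv φ (s * v) * v / c) s :=
    (((hφ _).hasDerivAt).comp s h1).div_const c
  have h3 : HasDerivAt (fun x : ℝ => Complex.log (φ (x * v) / c)) (deriv φ (s * v) * v / c) s := by
    have := h2.clog_real (by rw [← hc, div_self hs]; exact Complex.one_mem_slitPlane)
    rwa [← hc, div_self hs, div_one] at this
  have h4 : HasDerivAt (fun x : ℝ => (Complex.log (φ (x * v) / c)).re + Real.log ‖c‖)
      (deriv φ (s * v) * v / c).re s :=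
    ((Complex.reCLM.hasFDerivAt.comp_hasDerivAt s h3)).add_const _
  have h5 : (v * logDeriv φ (s * v)) = deriv φ (s * v) * v / c := by
    rw [logDeriv_apply, ← hc]; ring
  rw [h5]
  refine h4.congr_of_eventuallyEq ?_
  have hcont : ContinuousAt (fun x : ℝ => φ (x * v)) s := by
    have := hφ.continuous
    fun_prop
  filter_upwards [hcont.eventually_ne hs] with x hx
  rw [Complex.log_re, norm_div, Real.log_div (by simpa using hx) (by simpa using hs)]
  ring

/-- Some line through the origin carries an interval around the origin on which `log ‖φ‖` is
strictly increasing and strictly convex. -/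
theorem exists_strictConvexOn_log_norm {φ : ℂ → ℂ} (hφ : Differentiable ℂ φ) (h0 : φ 0 ≠ 0)
    (h2 : iteratedDeriv 2 φ 0 * φ 0 ≠ (deriv φ 0) ^ 2) (h1 : deriv φ 0 ≠ 0) :
    ∃ v : ℂ, v ≠ 0 ∧ ∃ δ : ℝ, 0 < δ ∧
      StrictConvexOn ℝ (Set.Icc (-δ) δ) (fun s : ℝ => Real.log ‖φ (s * v)‖) ∧
      StrictMonoOn (fun s : ℝ => Real.log ‖φ (s * v)‖) (Set.Icc (-δ) δ) ∧
      ∀ s ∈ Set.Icc (-δ) δ, φ (s * v) ≠ 0 := by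
  set q := logDeriv φ with hq
  have hdφ : Differentiable ℂ (deriv φ) := hφ.deriv
  have hddφ : Differentiable ℂ (deriv (deriv φ)) := hdφ.deriv
  set q' : ℂ → ℂ := fun z => (deriv (deriv φ) z * φ z - deriv φ z * deriv φ z) / φ z ^ 2 with hq'
  have hqd : ∀ z, φ z ≠ 0 → HasDerivAt q (q' z) z := fun z hz =>
    (hdφ z).hasDerivAt.div (hφ z).hasDerivAt hz
  have hq0 : q 0 ≠ 0 := by rw [hq, logDeriv_apply]; exact div_ne_zero h1 h0
  have hq'0 : q' 0 ≠ 0 := by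
    refine div_ne_zero ?_ (pow_ne_zero _ h0)
    rw [iteratedDeriv_succ, iteratedDeriv_one] at h2
    rw [← pow_two]
    exact sub_ne_zero.2 h2
  -- Along `s ↦ s v` the first two derivatives of `log ‖φ‖` are `Re (v q)` and `Re (v ^ 2 q')`.
  obtain ⟨v, hv1, hv2⟩ := exists_re_mul_pos_and_re_sq_mul_pos hq0 hq'0
  have hv : v ≠ 0 := by rintro rfl; simp at hv1
  have hline : Continuous fun s : ℝ => (s : ℂ) * v := by fun_prop
  have hcφ : ContinuousAt (fun s : ℝ => φ (s * v)) 0 := (hφ.continuous.comp hline).continuousAt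
  have hcq : ContinuousAt (fun s : ℝ => (v * q (s * v)).re) 0 := by
    have : ContinuousAt q ((0 : ℝ) * v) := by simpa using (hqd 0 h0).continuousAt
    have := ContinuousAt.comp (f := fun s : ℝ => (s : ℂ) * v) this hline.continuousAt
    exact Complex.continuous_re.continuousAt.comp (continuousAt_const.mul this)
  have hcq' : ContinuousAt (fun s : ℝ => (v ^ 2 * q' (s * v)).re) 0 := by
    have : ContinuousAt q' ((0 : ℝ) * v) := by
      refine ContinuousAt.div ?_ (hφ.continuous.pow 2).continuousAt (by simpa using h0)
      exact ((hddφ.continuous.mul hφ.continuous).sub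
        (hdφ.continuous.mul hdφ.continuous)).continuousAt
    have := ContinuousAt.comp (f := fun s : ℝ => (s : ℂ) * v) this hline.continuousAt
    exact Complex.continuous_re.continuousAt.comp (continuousAt_const.mul this)
  have hev : ∀ᶠ s : ℝ in 𝓝 0, φ (s * v) ≠ 0 ∧ 0 < (v * q (s * v)).re ∧
      0 < (v ^ 2 * q' (s * v)).re := by
    refine (hcφ.eventually_ne (by simpa using h0)).and ((hcq.eventually_const_lt ?_).and
      (hcq'.eventually_const_lt ?_))
    · simpa only [Complex.ofReal_zero, zero_mul] using hv1
    · simpa only [Complex.ofReal_zero, zero_mul] using hv2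
  obtain ⟨δ, hδ, hball⟩ := Metric.nhds_basis_closedBall.eventually_iff.1 hev
  have hIcc : ∀ {s : ℝ}, s ∈ Set.Icc (-δ) δ → φ (s * v) ≠ 0 ∧ 0 < (v * q (s * v)).re ∧
      0 < (v ^ 2 * q' (s * v)).re := by
    intro s hs
    exact hball (by simpa [abs_le] using hs)
  have hH : ∀ s ∈ Set.Icc (-δ) δ, HasDerivAt (fun s : ℝ => Real.log ‖φ (s * v)‖)
      (v * q (s * v)).re s := fun s hs =>
    hasDerivAt_log_norm_comp_ofReal_mul hφ v (hIcc hs).1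
  have hH' : ∀ s ∈ Set.Icc (-δ) δ, HasDerivAt (fun s : ℝ => (v * q (s * v)).re)
      (v ^ 2 * q' (s * v)).re s := by
    intro s hs
    have e1 : HasDerivAt (fun x : ℝ => (x : ℂ) * v) v s := by
      simpa using (Complex.ofRealCLM.hasDerivAt (x := s)).mul_const v
    have e2 := ((hqd _ (hIcc hs).1).comp s e1).const_mul v
    have e3 := Complex.reCLM.hasFDerivAt.comp_hasDerivAt s e2
    refine e3.congr_deriv ?_
    simp only [Complex.reCLM_apply]
    congr 1
    ring
  have hHc : ContinuousOn (fun s : ℝ => Real.log ‖φ (s * v)‖) (Set.Icc (-δ) δ) :=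
    fun s hs => (hH s hs).continuousAt.continuousWithinAt
  have hmono' : StrictMonoOn (fun s : ℝ => (v * q (s * v)).re) (Set.Icc (-δ) δ) := by
    refine strictMonoOn_of_deriv_pos (convex_Icc _ _)
      (fun s hs => (hH' s hs).continuousAt.continuousWithinAt) ?_
    intro s hs
    rw [(hH' s (interior_subset hs)).deriv]
    exact (hIcc (interior_subset hs)).2.2
  refine ⟨v, hv, δ, hδ, ?_, ?_, fun s hs => (hIcc hs).1⟩
  · refine StrictMonoOn.strictConvexOn_of_deriv (convex_Icc _ _) hHc ?_
    refine (hmono'.mono interior_subset).congr ?_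
    intro s hs
    exact (hH s (interior_subset hs)).deriv.symm
  · refine strictMonoOn_of_deriv_pos (convex_Icc _ _) hHc ?_
    intro s hs
    rw [(hH s (interior_subset hs)).deriv]
    exact (hIcc (interior_subset hs)).2.1

/-! ### Strict Jensen estimate -/

/-- Jensen's inequality with the missing mass placed at the origin, followed by a shift to the left:
the inequality is strict except for a point mass without shift. -/
theorem StrictConvexOn.map_sub_add_sum_lt {H : ℝ → ℝ} {δ : ℝ}
    (hconv : StrictConvexOn ℝ (Set.Icc (-δ) δ) H) (hmono : StrictMonoOn H (Set.Icc (-δ) δ))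
    (h0 : H 0 = 0) {F : Finset ℝ} (hF : (F : Set ℝ) ⊆ Set.Ioo 0 δ) {d r : ℕ} (hd : 1 ≤ d)
    (hr : r ≤ d) {κ : ℝ → ℕ} (hκ : ∑ s ∈ F, κ s = r) {x : ℝ} (hx : x ∈ Set.Icc 0 δ)
    (hstrict : 0 < x ∨ (1 ≤ r ∧ r < d) ∨ ∃ s ∈ F, ∃ s' ∈ F, s ≠ s' ∧ κ s ≠ 0 ∧ κ s' ≠ 0) :
    H (-x + ∑ s ∈ F, κ s * (s / d)) < ∑ s ∈ F, κ s * (H s / d) := by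
  have hδ : 0 ≤ δ := hx.1.trans hx.2
  have hd0 : (0 : ℝ) < d := by exact_mod_cast hd
  have h0F : (0 : ℝ) ∉ F := fun h => lt_irrefl _ (hF h).1
  set w : ℝ → ℝ := fun s => if s = 0 then ((d : ℝ) - r) / d else κ s / d with hw
  have hwF : ∀ s ∈ F, w s = κ s / d := fun s hs => if_neg fun h => h0F (by rwa [h] at hs)
  have hw0 : w 0 = ((d : ℝ) - r) / d := if_pos rfl
  have hsum : ∑ s ∈ insert 0 F, w s = 1 := by
    rw [Finset.sum_insert h0F, Finset.sum_congr rfl hwF, hw0, ← Finset.sum_div, ← Nat.cast_sum, hκ]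
    field_simp
    ring
  have hwnn : ∀ s ∈ insert 0 F, 0 ≤ w s := by
    intro s _
    have : (r : ℝ) ≤ d := by exact_mod_cast hr
    simp only [hw]
    split_ifs
    · exact div_nonneg (by linarith) hd0.le
    · positivity
  have hmem : ∀ s ∈ insert 0 F, s ∈ Set.Icc (-δ) δ := by
    intro s hs
    rcases Finset.mem_insert.1 hs with rfl | hs
    · exact ⟨by linarith, hδ⟩
    · exact ⟨by linarith [(hF hs).1], (hF hs).2.le⟩
  have hσ : ∑ s ∈ insert 0 F, w s • s = ∑ s ∈ F, κ s * (s / d) := by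
    rw [Finset.sum_insert h0F, smul_zero, zero_add]
    refine Finset.sum_congr rfl fun s hs => ?_
    rw [hwF s hs, smul_eq_mul]; ring
  have hHσ : ∑ s ∈ insert 0 F, w s • H s = ∑ s ∈ F, κ s * (H s / d) := by
    rw [Finset.sum_insert h0F, h0, smul_zero, zero_add]
    refine Finset.sum_congr rfl fun s hs => ?_
    rw [hwF s hs, smul_eq_mul]; ring
  have hσmem : ∑ s ∈ F, κ s * (s / d) ∈ Set.Icc (-δ) δ := by
    rw [← hσ]; exact (convex_Icc (-δ) δ).sum_mem hwnn hsum hmem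
  have hσ0 : 0 ≤ ∑ s ∈ F, κ s * (s / d) :=
    Finset.sum_nonneg fun s hs => mul_nonneg (by positivity) (div_nonneg (hF hs).1.le hd0.le)
  have hle : H (∑ s ∈ F, κ s * (s / d)) ≤ ∑ s ∈ F, κ s * (H s / d) := by
    rw [← hσ, ← hHσ]; exact hconv.convexOn.map_sum_le hwnn hsum hmem
  have hxmem : -x + ∑ s ∈ F, κ s * (s / d) ∈ Set.Icc (-δ) δ :=
    ⟨by linarith [hx.2], by linarith [hx.1, hσmem.2]⟩
  rcases hx.1.eq_or_lt with rfl | hx0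
  swap
  · exact (hmono hxmem hσmem (by linarith)).trans_le hle
  rw [neg_zero, zero_add]
  -- Without a shift, strictness needs two distinct points of nonzero weight, one of which may be
  -- the origin.
  have hstep : ∀ a ∈ insert 0 F, ∀ b ∈ insert 0 F, a ≠ b → w a ≠ 0 → w b ≠ 0 →
      H (∑ s ∈ F, κ s * (s / d)) < ∑ s ∈ F, κ s * (H s / d) := by
    intro a ha b hb hab hwa hwb
    rw [← hσ, ← hHσ]
    exact (hconv.map_sum_lt_iff_of_nonneg hwnn hsum hmem).2 ⟨a, ha, b, hb, hwa, hwb, hab⟩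
  rcases hstrict with h | ⟨h1, h2⟩ | ⟨s, hs, s', hs', hne, h1, h2⟩
  · exact absurd h (lt_irrefl _)
  · obtain ⟨s, hs, hκs⟩ : ∃ s ∈ F, κ s ≠ 0 := by
      by_contra! hall
      rw [Finset.sum_eq_zero hall] at hκ
      omega
    refine hstep 0 (by simp) s (by simp [hs]) (fun h => h0F (by rwa [← h] at hs)) ?_ ?_
    · rw [hw0]
      have : (r : ℝ) < d := by exact_mod_cast h2
      exact div_ne_zero (by linarith) hd0.ne'
    · rw [hwF s hs]; positivity
  · refine hstep s (by simp [hs]) s' (by simp [hs']) hne ?_ ?_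
    · rw [hwF s hs]; positivity
    · rw [hwF s' hs']; positivity

/-! ### Algebra of the exponential family -/

section Exponential

variable {X : Type*} [CommRing X] {e : ℝ → X}

theorem exponential_pow (h0 : e 0 = 1) (hadd : ∀ a b, e a * e b = e (a + b)) (a : ℝ) (k : ℕ) :
    e a ^ k = e (k * a) := by
  induction k with
  | zero => simp [h0]
  | succ k ih => rw [pow_succ, ih, hadd]; congr 1; push_cast; ring

theorem exponential_prod (h0 : e 0 = 1) (hadd : ∀ a b, e a * e b = e (a + b)) {ι : Type*}
    (F : Finset ι) (g : ι → ℝ) : ∏ i ∈ F, e (g i) = e (∑ i ∈ F, g i) := by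
  classical
  induction F using Finset.induction_on with
  | empty => simp [h0]
  | insert i F hi ih => rw [Finset.prod_insert hi, Finset.sum_insert hi, ih, hadd]

variable [Algebra ℂ X]

/-- Frequencies add under multiplication. With `ε = δ / d`, products of at most `d` approximants
keep frequencies in `(-δ, 0)`. -/
theorem span_exponential_pow_le (hadd : ∀ a b, e a * e b = e (a + b)) (ε : ℝ) {l : ℕ}
    (hl : 1 ≤ l) :
    Submodule.span ℂ (e '' Set.Ioo (-ε) 0) ^ l ≤ Submodule.span ℂ (e '' Set.Ioo (-(l * ε)) 0) := by
  induction l, hl using Nat.le_induction with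
  | base => simp
  | succ l hl ih =>
    rw [pow_succ]
    refine (mul_le_mul' ih le_rfl).trans ?_
    rw [Submodule.span_mul_span]
    refine Submodule.span_mono ?_
    rintro _ ⟨_, ⟨a, ha, rfl⟩, _, ⟨b, hb, rfl⟩, rfl⟩
    refine ⟨a + b, ⟨?_, ?_⟩, (hadd a b).symm⟩
    · push_cast
      linarith [ha.1, hb.1]
    · linarith [ha.2, hb.2]

variable [TopologicalSpace X] {T : X →L[ℂ] X} {χ : ℝ → ℂ}

theorem pow_apply_exponential (hT : ∀ s, T (e s) = χ s • e s) (s : ℝ) (n : ℕ) :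
    (T ^ n) (e s) = χ s ^ n • e s := by
  induction n with
  | zero => simp
  | succ n ih =>
    rw [pow_succ', mul_apply_eq_comp, ih, map_smul, hT, smul_smul, pow_succ]

end Exponential

/-! ### Steering perturbations -/

section Perturbation

variable {X : Type*} [CommRing X] [Algebra ℂ X]

/-- The vectors added to approximants in order to steer the orbits of their polynomial values. -/
noncomputable def perturbation (e : ℝ → X) (d : ℕ) (F : Finset ℝ) (γ ρ : ℝ → ℂ) (n : ℕ) : X :=
  ∑ s ∈ F, (γ s * ρ s ^ n) • e (s / d)

theorem tendsto_perturbation [TopologicalSpace X] [IsTopologicalRing X] [ContinuousSMul ℂ X]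
    (e : ℝ → X) (d : ℕ) {F : Finset ℝ} (γ : ℝ → ℂ) {ρ : ℝ → ℂ} (hρ : ∀ s ∈ F, ‖ρ s‖ < 1) :
    Tendsto (perturbation e d F γ ρ) atTop (𝓝 0) := by
  have : Tendsto (fun n => ∑ s ∈ F, (γ s * ρ s ^ n) • e (s / d)) atTop
      (𝓝 (∑ s ∈ F, (γ s * 0) • e (s / d))) :=
    tendsto_finsetSum _ fun s hs =>
      ((tendsto_pow_atTop_nhds_zero_of_norm_lt_one (hρ s hs)).const_mul _).smul_const _
  simp only [mul_zero, zero_smul, Finset.sum_const_zero] at this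
  exact this

theorem perturbation_pow {e : ℝ → X} (h0 : e 0 = 1) (hadd : ∀ a b, e a * e b = e (a + b))
    (d : ℕ) (F : Finset ℝ) (γ ρ : ℝ → ℂ) (n r : ℕ) :
    perturbation e d F γ ρ n ^ r = ∑ κ ∈ F.piAntidiag r,
      (Nat.multinomial F κ * (∏ s ∈ F, γ s ^ κ s) * (∏ s ∈ F, ρ s ^ κ s) ^ n : ℂ) •
        e (∑ s ∈ F, κ s * (s / d)) := by
  rw [perturbation, Finset.sum_pow_eq_sum_piAntidiag]
  refine Finset.sum_congr rfl fun κ _ => ?_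
  simp_rw [smul_pow, exponential_pow h0 hadd, Finset.prod_smul, exponential_prod h0 hadd]
  rw [mul_smul_comm, ← nsmul_eq_mul, ← Nat.cast_smul_eq_nsmul ℂ, smul_smul]
  congr 1
  simp_rw [mul_pow, Finset.prod_mul_distrib, ← Finset.prod_pow, ← pow_mul]
  simp_rw [mul_comm n]
  ring

variable [TopologicalSpace X] {T : X →L[ℂ] X} {e : ℝ → X} {χ : ℝ → ℂ}

/-- By the multinomial theorem every term is a geometric sequence in `n`, so its fate depends only
on its ratio. -/
theorem pow_apply_mul_perturbation_pow (h0 : e 0 = 1) (hadd : ∀ a b, e a * e b = e (a + b))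
    (hT : ∀ s, T (e s) = χ s • e s) (d : ℕ) (F : Finset ℝ) (γ ρ : ℝ → ℂ) (n r : ℕ) (x : ℝ) :
    (T ^ n) (e (-x) * perturbation e d F γ ρ n ^ r) = ∑ κ ∈ F.piAntidiag r,
      (Nat.multinomial F κ * (∏ s ∈ F, γ s ^ κ s) *
        (χ (-x + ∑ s ∈ F, κ s * (s / d)) * ∏ s ∈ F, ρ s ^ κ s) ^ n : ℂ) •
          e (-x + ∑ s ∈ F, κ s * (s / d)) := by
  rw [perturbation_pow h0 hadd, Finset.mul_sum, map_sum]
  refine Finset.sum_congr rfl fun κ _ => ?_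
  rw [mul_smul_comm, hadd, map_smul, pow_apply_exponential hT, smul_smul, mul_pow]
  congr 1
  ring

/-- A one-parameter group `e` of eigenvectors of `T` with eigenvalues `χ`, such that `log ‖χ‖` is
strictly convex and strictly increasing near the origin, where it vanishes. -/
structure IsConvexEigenfamily (T : X →L[ℂ] X) (e : ℝ → X) (χ : ℝ → ℂ) (δ : ℝ) : Prop where
  map_zero : e 0 = 1
  map_add : ∀ a b, e a * e b = e (a + b)
  apply : ∀ s, T (e s) = χ s • e s
  pos : 0 < δ
  convex : StrictConvexOn ℝ (Set.Icc (-δ) δ) fun s => Real.log ‖χ s‖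
  mono : StrictMonoOn (fun s => Real.log ‖χ s‖) (Set.Icc (-δ) δ)
  norm_zero : ‖χ 0‖ = 1
  ne_zero : ∀ s ∈ Set.Icc (-δ) δ, χ s ≠ 0

/-- Since `log ‖ρ s‖ = -log ‖χ s‖ / d`, taking logarithms turns this into the strict Jensen
estimate. -/
theorem norm_mul_prod_pow_lt_one {δ : ℝ} (h : IsConvexEigenfamily T e χ δ)
    {F : Finset ℝ}
    (hF : (F : Set ℝ) ⊆ Set.Ioo 0 δ) {d r : ℕ} (hd : 1 ≤ d) (hr : r ≤ d) {ρ : ℝ → ℂ}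
    (hρ : ∀ s ∈ F, ρ s ^ d = (χ s)⁻¹) {κ : ℝ → ℕ} (hκ : ∑ s ∈ F, κ s = r) {x : ℝ}
    (hx : x ∈ Set.Icc 0 δ)
    (hstrict : 0 < x ∨ (1 ≤ r ∧ r < d) ∨ ∃ s ∈ F, ∃ s' ∈ F, s ≠ s' ∧ κ s ≠ 0 ∧ κ s' ≠ 0) :
    ‖χ (-x + ∑ s ∈ F, κ s * (s / d)) * ∏ s ∈ F, ρ s ^ κ s‖ < 1 := by
  have hlt := h.convex.map_sub_add_sum_lt h.mono (by simp [h.norm_zero]) hF hd hr hκ hx hstrict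
  have hd0 : (d : ℝ) ≠ 0 := by positivity
  have hFne : ∀ s ∈ F, χ s ≠ 0 := fun s hs => h.ne_zero s ⟨by linarith [(hF hs).1, h.pos], (hF hs).2.le⟩
  have hρne : ∀ s ∈ F, ρ s ≠ 0 := fun s hs hs0 => by
    have := hρ s hs
    rw [hs0, zero_pow (by omega)] at this
    exact inv_ne_zero (hFne s hs) this.symm
  have hlogρ : ∀ s ∈ F, Real.log ‖ρ s‖ = -(Real.log ‖χ s‖ / d) := by
    intro s hs
    have := congrArg (fun z => Real.log ‖z‖) (hρ s hs)
    simp only [norm_pow, norm_inv, Real.log_pow, Real.log_inv] at this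
    field_simp
    linarith
  by_cases hz : χ (-x + ∑ s ∈ F, κ s * (s / d)) = 0
  · simp [hz]
  have hprod : ∀ s ∈ F, ‖ρ s‖ ^ κ s ≠ 0 := fun s hs => pow_ne_zero _ (norm_ne_zero_iff.2 (hρne s hs))
  rw [norm_mul, norm_prod]
  simp_rw [norm_pow]
  have hpos : 0 < ‖χ (-x + ∑ s ∈ F, κ s * (s / d))‖ * ∏ s ∈ F, ‖ρ s‖ ^ κ s :=
    mul_pos (norm_pos_iff.2 hz) (Finset.prod_pos fun s hs => (hprod s hs).symm.lt_of_le (by positivity))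
  rw [← Real.log_neg_iff hpos, Real.log_mul (norm_ne_zero_iff.2 hz) (Finset.prod_ne_zero_iff.2 hprod),
    Real.log_prod hprod]
  simp_rw [Real.log_pow]
  have hsum : ∑ s ∈ F, κ s * Real.log ‖ρ s‖ = -∑ s ∈ F, κ s * (Real.log ‖χ s‖ / d) := by
    rw [← Finset.sum_neg_distrib]
    exact Finset.sum_congr rfl fun s hs => by rw [hlogρ s hs, mul_neg]
  linarith

variable [ContinuousSMul ℂ X]

theorem tendsto_multinomial_term_zero {δ : ℝ} (h : IsConvexEigenfamily T e χ δ) {F : Finset ℝ}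
    (hF : (F : Set ℝ) ⊆ Set.Ioo 0 δ) {d : ℕ} (hd : 1 ≤ d) {ρ : ℝ → ℂ}
    (hρ : ∀ s ∈ F, ρ s ^ d = (χ s)⁻¹) (γ : ℝ → ℂ) {r : ℕ} (hr : r ≤ d)
    {κ : ℝ → ℕ} (hκ : κ ∈ F.piAntidiag r) {x : ℝ} (hx : x ∈ Set.Icc 0 δ)
    (hstrict : 0 < x ∨ (1 ≤ r ∧ r < d) ∨ ∃ s ∈ F, ∃ s' ∈ F, s ≠ s' ∧ κ s ≠ 0 ∧ κ s' ≠ 0) :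
    Tendsto (fun n : ℕ => (Nat.multinomial F κ * (∏ s ∈ F, γ s ^ κ s) *
      (χ (-x + ∑ s ∈ F, κ s * (s / d)) * ∏ s ∈ F, ρ s ^ κ s) ^ n : ℂ) •
        e (-x + ∑ s ∈ F, κ s * (s / d))) atTop (𝓝 0) := by
  have := tendsto_pow_atTop_nhds_zero_of_norm_lt_one (norm_mul_prod_pow_lt_one h
    hF hd hr hρ (Finset.mem_piAntidiag.1 hκ).1 hx hstrict)
  simpa using (this.const_mul (Nat.multinomial F κ * (∏ s ∈ F, γ s ^ κ s) : ℂ)).smul_const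
    (e (-x + ∑ s ∈ F, κ s * (s / d)))

variable [IsTopologicalRing X]

theorem tendsto_perturbation_zero {δ : ℝ} (h : IsConvexEigenfamily T e χ δ) {F : Finset ℝ}
    (hF : (F : Set ℝ) ⊆ Set.Ioo 0 δ) {d : ℕ} (hd : 1 ≤ d) {ρ : ℝ → ℂ}
    (hρ : ∀ s ∈ F, ρ s ^ d = (χ s)⁻¹) (γ : ℝ → ℂ) :
    Tendsto (perturbation e d F γ ρ) atTop (𝓝 0) := by
  refine tendsto_perturbation e d γ fun s hs => ?_
  have hs' := hF hs
  have hpos : 0 < Real.log ‖χ s‖ := by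
    have := h.mono (a := 0) ⟨by linarith [h.pos], h.pos.le⟩ ⟨by linarith [hs'.1, h.pos], hs'.2.le⟩ hs'.1
    simpa [h.norm_zero] using this
  have h1 : 1 < ‖χ s‖ := (Real.log_pos_iff (norm_nonneg _)).1 hpos
  have h2 : ‖ρ s‖ ^ d < 1 := by
    rw [← norm_pow, hρ s hs, norm_inv]; exact inv_lt_one_of_one_lt₀ h1
  exact (pow_lt_one_iff_of_nonneg (norm_nonneg _) (by omega)).1 h2

/-- Only the pure powers with `r = d` have ratio 1, as `χ s * ρ s ^ d = 1`; they contribute `γ s ^ d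
• e s`. The case `r = 0` is excluded because `‖χ 0‖ = 1` gives no decay. -/
theorem tendsto_pow_apply_perturbation_pow {δ : ℝ} (h : IsConvexEigenfamily T e χ δ) {F : Finset ℝ}
    (hF : (F : Set ℝ) ⊆ Set.Ioo 0 δ) {d : ℕ} (hd : 1 ≤ d) {ρ : ℝ → ℂ}
    (hρ : ∀ s ∈ F, ρ s ^ d = (χ s)⁻¹)
    {c γ : ℝ → ℂ} (hγ : ∀ s ∈ F, γ s ^ d = c s) {r : ℕ} (hr1 : 1 ≤ r) (hr : r ≤ d) :
    Tendsto (fun n => (T ^ n) (perturbation e d F γ ρ n ^ r)) atTop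
      (𝓝 (if r = d then ∑ s ∈ F, c s • e s else 0)) := by
  classical
  have hx0 : (0 : ℝ) ∈ Set.Icc 0 δ := ⟨le_rfl, h.pos.le⟩
  have hexp := fun n => pow_apply_mul_perturbation_pow h.map_zero h.map_add h.apply d F γ ρ n r 0
  simp only [neg_zero, h.map_zero, one_mul] at hexp
  simp_rw [hexp]
  by_cases hrd : r = d
  swap
  · have hz : (0 : X) = ∑ κ ∈ F.piAntidiag r, 0 := by simp
    rw [if_neg hrd, hz]
    refine tendsto_finsetSum _ fun κ hκ => ?_
    simpa using tendsto_multinomial_term_zero h hF hd hρ γ hr hκ hx0 (Or.inr (Or.inl ⟨hr1, by omega⟩))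
  subst hrd
  -- The limit is indexed by the same `κ` as the expansion, so that limits can be taken term by
  -- term.
  have hlim : (if r = r then ∑ s ∈ F, c s • e s else 0) =
      ∑ κ ∈ F.piAntidiag r, ∑ s ∈ F, if κ = Pi.single s r then c s • e s else 0 := by
    rw [if_pos rfl, Finset.sum_comm]
    refine Finset.sum_congr rfl fun s hs => ?_
    rw [Finset.sum_ite_eq', if_pos]
    rw [Finset.mem_piAntidiag]
    refine ⟨by simp [hs], fun i hi => ?_⟩
    by_contra hiF
    exact hi (Pi.single_eq_of_ne (fun his => hiF (by rwa [his])) _)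
  rw [hlim]
  refine tendsto_finsetSum _ fun κ hκ => ?_
  by_cases hκs : ∃ s ∈ F, κ = Pi.single s r
  · obtain ⟨s, hs, rfl⟩ := hκs
    have hinj : ∀ s', (Pi.single s r : ℝ → ℕ) = Pi.single s' r ↔ s = s' := by
      intro s'
      refine ⟨fun h => ?_, fun h => by rw [h]⟩
      by_contra hne
      have := congrFun h s
      rw [Pi.single_eq_same, Pi.single_eq_of_ne hne] at this
      omega
    simp only [hinj]
    rw [Finset.sum_ite_eq, if_pos hs]
    have hprod : ∀ f : ℝ → ℂ, ∏ i ∈ F, f i ^ (Pi.single s r : ℝ → ℕ) i = f s ^ r := by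
      intro f
      rw [Finset.prod_eq_single_of_mem s hs fun i _ hi => by rw [Pi.single_eq_of_ne hi, pow_zero],
        Pi.single_eq_same]
    have hsum : ∑ i ∈ F, ((Pi.single s r : ℝ → ℕ) i : ℝ) * (i / r) = s := by
      rw [Finset.sum_eq_single_of_mem s hs fun i _ hi => by
        rw [Pi.single_eq_of_ne hi, Nat.cast_zero, zero_mul], Pi.single_eq_same]
      field_simp
    have hmult : Nat.multinomial F (Pi.single s r : ℝ → ℕ) = 1 := by
      rw [Nat.multinomial, (Finset.mem_piAntidiag.1 hκ).1, Finset.prod_eq_single_of_mem s hs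
        fun i _ hi => by rw [Pi.single_eq_of_ne hi, Nat.factorial_zero], Pi.single_eq_same]
      exact Nat.div_self (Nat.factorial_pos r)
    simp_rw [hprod, hsum, hmult, hγ s hs, hρ s hs, zero_add]
    have : χ s ≠ 0 := h.ne_zero s ⟨by linarith [(hF hs).1, h.pos], (hF hs).2.le⟩
    simpa [this] using tendsto_const_nhds
  · have hzero : ∑ s ∈ F, (if κ = Pi.single s r then c s • e s else 0) = 0 :=
      Finset.sum_eq_zero fun s hs => if_neg fun h => hκs ⟨s, hs, h⟩
    rw [hzero]
    suffices hdist : ∃ s ∈ F, ∃ s' ∈ F, s ≠ s' ∧ κ s ≠ 0 ∧ κ s' ≠ 0 by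
      have := tendsto_multinomial_term_zero h hF hd hρ γ hr hκ hx0 (Or.inr (Or.inr hdist))
      simp only [neg_zero] at this
      exact this
    rw [Finset.mem_piAntidiag] at hκ
    by_contra! hall
    obtain ⟨s, hs, hκ0⟩ : ∃ s ∈ F, κ s ≠ 0 := by
      by_contra! hall
      have := hκ.1
      rw [Finset.sum_eq_zero hall] at this
      omega
    have hother : ∀ s', s' ≠ s → κ s' = 0 := by
      intro s' hs'
      by_contra hk
      exact hk (hall s hs s' (hκ.2 s' hk) hs'.symm hκ0)
    refine hκs ⟨s, hs, funext fun s' => ?_⟩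
    by_cases hs' : s' = s
    · subst hs'
      rw [Pi.single_eq_same, ← hκ.1]
      exact (Finset.sum_eq_single_of_mem s' hs fun i _ hi => hother i hi).symm
    · rw [hother s' hs', Pi.single_eq_of_ne hs']

/-- Each frequency of `C` is a genuine left shift by less than `δ`, which forces decay even when `l
+ r = d`. -/
theorem tendsto_pow_apply_mul_perturbation_pow_zero {δ : ℝ} (h : IsConvexEigenfamily T e χ δ) {F : Finset ℝ}
    (hF : (F : Set ℝ) ⊆ Set.Ioo 0 δ) {d : ℕ} (hd : 1 ≤ d) {ρ : ℝ → ℂ}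
    (hρ : ∀ s ∈ F, ρ s ^ d = (χ s)⁻¹) (γ : ℝ → ℂ) {l r : ℕ}
    (hl : 1 ≤ l) (hlr : l + r ≤ d) {C : X}
    (hC : C ∈ Submodule.span ℂ (e '' Set.Ioo (-(δ / d)) 0) ^ l) :
    Tendsto (fun n => (T ^ n) (C * perturbation e d F γ ρ n ^ r)) atTop (𝓝 0) := by
  have hd0 : (d : ℝ) ≠ 0 := by positivity
  replace hC := span_exponential_pow_le h.map_add (δ / d) hl hC
  induction hC using Submodule.span_induction with
  | mem y hy =>
    obtain ⟨x, hx, rfl⟩ := hy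
    have hle : (l : ℝ) * (δ / d) ≤ δ := by
      have : (l : ℝ) ≤ d := by exact_mod_cast (by omega : l ≤ d)
      calc (l : ℝ) * (δ / d) ≤ d * (δ / d) := by have := h.pos; gcongr
        _ = δ := by field_simp
    have hexp := fun n => pow_apply_mul_perturbation_pow h.map_zero h.map_add h.apply d F γ ρ n r (-x)
    simp_rw [neg_neg] at hexp
    simp_rw [hexp]
    rw [← Finset.sum_const_zero (s := F.piAntidiag r)]
    refine tendsto_finsetSum _ fun κ hκ => ?_
    simpa using tendsto_multinomial_term_zero h hF hd hρ γ (by omega) hκ (x := -x) ⟨by linarith [hx.2], by linarith [hx.1]⟩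
      (Or.inl (by linarith [hx.2]))
  | zero => simpa using tendsto_const_nhds
  | add y z _ _ hy hz => simpa [add_mul] using hy.add hz
  | smul a y _ hy => simpa using hy.const_smul a

/-- Steering: a null sequence `B` such that, for all approximants `A i` in a suitable span and all
weights `t i`, the iterates `T ^ n` send the products of at most `d` of the `A i + t i • B n` to
zero, except that products of exactly `d` of them are sent to the corresponding multiple of `u`. -/
theorem IsConvexEigenfamily.exists_steering_sequence {δ : ℝ} (h : IsConvexEigenfamily T e χ δ)
    {d : ℕ} (hd : 1 ≤ d) {u : X} (hu : u ∈ Submodule.span ℂ (e '' Set.Ioo 0 δ)) :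
    ∃ B : ℕ → X, Tendsto B atTop (𝓝 0) ∧ ∀ {ι : Type} (A : ι → X) (t : ι → ℂ),
      (∀ i, A i ∈ Submodule.span ℂ (e '' Set.Ioo (-(δ / d)) 0)) → ∀ m : Multiset ι,
      1 ≤ m.card → m.card ≤ d →
        Tendsto (fun n => (T ^ n) (m.map fun i => A i + t i • B n).prod) atTop
          (𝓝 (if m.card = d then (m.map t).prod • u else 0)) := by
  obtain ⟨c, hcF, rfl⟩ := (Finsupp.mem_span_image_iff_linearCombination ℂ).1 hu
  have hF : (c.support : Set ℝ) ⊆ Set.Ioo 0 δ := (Finsupp.mem_supported ℂ c).1 hcF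
  have hroot : ∀ z : ℂ, ∃ y : ℂ, y ^ d = z := fun z => IsAlgClosed.exists_pow_nat_eq z hd
  choose γ hγ using fun s => hroot (c s)
  choose ρ hρ using fun s => hroot (χ s)⁻¹
  have hpure := fun r => tendsto_pow_apply_perturbation_pow h hF hd (fun s _ => hρ s)
    (fun s _ => hγ s) (r := r)
  have hmixed := fun l r (hl : 1 ≤ l) (hlr : l + r ≤ d) C =>
    tendsto_pow_apply_mul_perturbation_pow_zero h hF hd (fun s _ => hρ s) γ hl hlr (C := C)
  have hBnull := tendsto_perturbation_zero h hF hd (fun s _ => hρ s) γ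
  generalize hu' : Finsupp.linearCombination ℂ e c = u
  rw [Finsupp.linearCombination_apply, Finsupp.sum] at hu'
  rw [hu'] at hpure
  generalize perturbation e d c.support γ ρ = B at hpure hmixed hBnull
  refine ⟨B, hBnull, fun {ι} A t hA m hm1 hmd => ?_⟩
  -- Expanding one factor `A i + t i • B n` either enlarges `C` or raises the power of `B n`. Both
  -- kinds of prefix, with and without some `A i`, are therefore carried through the induction.
  have hprod : ∀ (m : Multiset ι), (∀ l r, 1 ≤ l → l + r + m.card ≤ d →
      ∀ C ∈ Submodule.span ℂ (e '' Set.Ioo (-(δ / d)) 0) ^ l,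
        Tendsto (fun n => (T ^ n) (C * B n ^ r * (m.map fun i => A i + t i • B n).prod)) atTop
          (𝓝 0)) ∧
      ∀ r, 1 ≤ r + m.card → r + m.card ≤ d →
        Tendsto (fun n => (T ^ n) (B n ^ r * (m.map fun i => A i + t i • B n).prod)) atTop
          (𝓝 (if r + m.card = d then (m.map t).prod • u else 0)) := by
    intro m
    induction m using Multiset.induction_on with
    | empty =>
      simp only [Multiset.card_zero, Multiset.map_zero, Multiset.prod_zero, mul_one, add_zero,
        one_smul]
      exact ⟨hmixed, hpure⟩
    | cons i m ih =>
      obtain ⟨ih1, ih2⟩ := ih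
      simp only [Multiset.card_cons, Multiset.map_cons, Multiset.prod_cons]
      constructor
      · intro l r hl hlr C hC
        have hCA : C * A i ∈ Submodule.span ℂ (e '' Set.Ioo (-(δ / d)) 0) ^ (l + 1) := by
          rw [pow_succ]; exact Submodule.mul_mem_mul hC (hA i)
        have h1 := ih1 (l + 1) r (by omega) (by omega) _ hCA
        have h2 := (ih1 l (r + 1) hl (by omega) C hC).const_smul (t i)
        have h3 := h1.add h2
        rw [smul_zero, add_zero] at h3
        refine h3.congr fun n => ?_
        rw [← map_smul, ← _root_.map_add]
        congr 1
        simp only [Algebra.smul_def]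
        ring
      · intro r hr1 hr
        have h1 := ih1 1 r le_rfl (by omega) (A i) (by rw [pow_one]; exact hA i)
        have h2 := (ih2 (r + 1) (by omega) (by omega)).const_smul (t i)
        have h3 := h1.add h2
        have hlim : (0 : X) + t i • (if r + 1 + m.card = d then
            (m.map t).prod • u else 0) =
            if r + (m.card + 1) = d then
              (t i * (m.map t).prod) • u else 0 := by
          rw [zero_add, smul_ite, smul_zero, smul_smul, add_assoc, add_comm 1]
        rw [hlim] at h3
        refine h3.congr fun n => ?_
        rw [← map_smul, ← _root_.map_add]
        congr 1
        simp only [Algebra.smul_def]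
        ring
  simpa using (hprod m).2 0 (by simpa using hm1) (by simpa using hmd)

end Perturbation

/-! ### Compact sets of polynomials and generic sequences -/

theorem isOpen_setOf_forall_sum_smul_mem {R M ι : Type*} [Semiring R] [TopologicalSpace R]
    [AddCommMonoid M] [TopologicalSpace M] [ContinuousAdd M] [Module R M] [ContinuousSMul R M]
    (S : Finset ι) {K : Set (ι → R)} (hK : IsCompact K) {U : Set M} (hU : IsOpen U) :
    IsOpen {v : ι → M | ∀ p ∈ K, ∑ i ∈ S, p i • v i ∈ U} := by
  rw [isOpen_iff_eventually]
  intro v hv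
  refine hK.eventually_forall_of_forall_eventually fun p hp => ?_
  have hcont : Continuous fun z : (ι → M) × (ι → R) => ∑ i ∈ S, z.2 i • z.1 i := by fun_prop
  exact hcont.continuousAt.eventually_mem (hU.mem_nhds (hv p hp))

theorem prod_map_toMultiset {ι R : Type*} [CommMonoid R] (f : ι → R) (α : ι →₀ ℕ) :
    (α.toMultiset.map f).prod = ∏ i ∈ α.support, f i ^ α i := by
  classical
  rw [Finset.prod_multiset_map_count, Finsupp.toFinset_toMultiset]
  simp_rw [Finsupp.count_toMultiset]

theorem card_toMultiset_eq_degree {ι : Type*} (α : ι →₀ ℕ) :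
    Multiset.card α.toMultiset = α.degree := by
  rw [Finsupp.card_toMultiset]; rfl

theorem aeval_eq_sum_toMultiset {ι R : Type*} [CommRing R] [Algebra ℂ R] (f : ι → R)
    (P : MvPolynomial ι ℂ) :
    MvPolynomial.aeval f P = ∑ α ∈ P.support, P.coeff α • (α.toMultiset.map f).prod := by
  rw [MvPolynomial.aeval_def, MvPolynomial.eval₂_eq]
  simp_rw [prod_map_toMultiset, Algebra.smul_def]

theorem eval_homogeneousComponent {ι : Type*} (t : ι → ℂ) (P : MvPolynomial ι ℂ) (d : ℕ) :
    MvPolynomial.eval t (P.homogeneousComponent d) = ∑ α ∈ P.support,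
      P.coeff α • if α.toMultiset.card = d then (α.toMultiset.map t).prod else 0 := by
  rw [MvPolynomial.homogeneousComponent_apply, map_sum, Finset.sum_filter]
  refine Finset.sum_congr rfl fun α _ => ?_
  simp_rw [card_toMultiset_eq_degree, smul_ite, smul_zero, MvPolynomial.eval_monomial,
    prod_map_toMultiset, smul_eq_mul]
  rfl

theorem homogeneousComponent_totalDegree_ne_zero {ι : Type*} {P : MvPolynomial ι ℂ} (hP : P ≠ 0) :
    P.homogeneousComponent P.totalDegree ≠ 0 := by
  obtain ⟨α, hα, hdeg⟩ := Finset.exists_mem_eq_sup P.support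
    (MvPolynomial.support_nonempty.2 hP) fun α => α.sum fun _ e => e
  have hdeg' : α.degree = P.totalDegree := hdeg.symm
  intro h
  have := congrArg (MvPolynomial.coeff α) h
  rw [MvPolynomial.coeff_homogeneousComponent, if_pos hdeg', MvPolynomial.coeff_zero] at this
  exact MvPolynomial.mem_support_iff.1 hα this

/-- Coefficient families bounded by `N` whose part of degree `d`, supported on `S`, takes the value
one at `t`. -/
def normalizedCoeffs {ι : Type*} (S : Finset (ι →₀ ℕ)) (d : ℕ) (t : ι → ℂ) (N : ℝ) :
    Set ((ι →₀ ℕ) → ℂ) :=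
  {p | (∀ α, ‖p α‖ ≤ N) ∧
    ∑ α ∈ S, p α • (if α.toMultiset.card = d then (α.toMultiset.map t).prod else 0) = 1}

/-- Tychonoff applies because all coefficients are bounded, also those outside `S`. -/
theorem isCompact_normalizedCoeffs {ι : Type*} (S : Finset (ι →₀ ℕ)) (d : ℕ) (t : ι → ℂ) (N : ℝ) :
    IsCompact (normalizedCoeffs S d t N) := by
  have h1 : IsCompact (Set.univ.pi fun _ : ι →₀ ℕ => Metric.closedBall (0 : ℂ) N) :=
    isCompact_univ_pi fun _ => isCompact_closedBall _ _
  have h2 : IsClosed {p : (ι →₀ ℕ) → ℂ |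
      ∑ α ∈ S, p α • (if α.toMultiset.card = d then (α.toMultiset.map t).prod else 0) = 1} :=
    isClosed_eq (by fun_prop) continuous_const
  convert h1.inter_right h2 using 1
  ext p
  simp [normalizedCoeffs, Set.mem_pi]

theorem IsHypercyclicVector.of_smul {X : Type*} [AddCommGroup X] [Module ℂ X]
    [TopologicalSpace X] [ContinuousConstSMul ℂ X] {T : X →L[ℂ] X} {g : X} {c : ℂ} (hc : c ≠ 0)
    (h : IsHypercyclicVector T (c • g)) : IsHypercyclicVector T g := by
  have hsurj : Function.Surjective fun x : X => c⁻¹ • x := fun x => ⟨c • x, inv_smul_smul₀ hc x⟩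
  have := hsurj.denseRange.dense_image (continuous_const_smul c⁻¹) h
  rw [← Set.range_comp] at this
  refine this.mono (Set.range_subset_range_iff_exists_comp.2 ⟨id, funext fun n => ?_⟩)
  simp [inv_smul_smul₀ hc]

theorem eventually_residual_denseRange {X : Type*} [TopologicalSpace X]
    [SecondCountableTopology X] :
    ∀ᶠ f in residual (ℕ → X), DenseRange f := by
  have hb := TopologicalSpace.isBasis_countableBasis X
  have : ∀ᶠ f in residual (ℕ → X), ∀ U : TopologicalSpace.countableBasis X,
      ∃ i, f i ∈ (U : Set X) := by
    rw [eventually_countable_forall]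
    intro U
    have hU := hb.isOpen U.2
    refine residual_of_dense_open (s := {f : ℕ → X | ∃ i, f i ∈ (U : Set X)}) ?_ ?_
    · rw [Set.ofPred_exists]
      exact isOpen_iUnion fun i => hU.preimage (continuous_apply i)
    · obtain ⟨u, hu⟩ := TopologicalSpace.nonempty_of_mem_countableBasis U.2
      -- Changing one far coordinate is a small change in the product topology.
      have hlim (f : ℕ → X) : Tendsto (fun n => Function.update f n u) atTop (𝓝 f) := by
        rw [tendsto_pi_nhds]
        intro i
        refine tendsto_const_nhds.congr' ?_
        filter_upwards [eventually_gt_atTop i] with n hn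
        rw [Function.update_of_ne hn.ne]
      exact fun f => mem_closure_of_tendsto (hlim f)
        (Eventually.of_forall fun n => ⟨n, by simpa using hu⟩)
  filter_upwards [this] with f hf
  refine hb.dense_iff.2 fun U hU _ => ?_
  obtain ⟨i, hi⟩ := hf ⟨U, hU⟩
  exact ⟨f i, hi, i, rfl⟩

/-! ### Baire category argument -/

section Baire

variable {X : Type*} [CommRing X] [Algebra ℂ X] [TopologicalSpace X] [IsTopologicalRing X]
  [ContinuousSMul ℂ X] {T : X →L[ℂ] X} {e : ℝ → X} {χ : ℝ → ℂ} {δ : ℝ}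

/-- The families at which some iterate of `T` sends the values of all polynomials with coefficients
in `K` into `U`. -/
def hittingSet (T : X →L[ℂ] X) (S : Finset (ℕ →₀ ℕ)) (K : Set ((ℕ →₀ ℕ) → ℂ)) (U : Set X) :
    Set (ℕ → X) :=
  {f | ∃ n, ∀ p ∈ K, ∑ α ∈ S, p α • (T ^ n) (α.toMultiset.map f).prod ∈ U}

theorem isOpen_hittingSet (T : X →L[ℂ] X) (S : Finset (ℕ →₀ ℕ)) {K : Set ((ℕ →₀ ℕ) → ℂ)}
    (hK : IsCompact K) {U : Set X} (hU : IsOpen U) : IsOpen (hittingSet T S K U) := by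
  have : hittingSet T S K U = ⋃ n, (fun (f : ℕ → X) (α : ℕ →₀ ℕ) =>
      (T ^ n) (α.toMultiset.map f).prod) ⁻¹' {v | ∀ p ∈ K, ∑ α ∈ S, p α • v α ∈ U} := by
    ext f; simp [hittingSet]
  rw [this]
  refine isOpen_iUnion fun n => (isOpen_setOf_forall_sum_smul_mem S hK hU).preimage ?_
  refine continuous_pi fun α => (T ^ n).continuous.comp ?_
  exact continuous_multiset_prod _ fun i _ => continuous_apply i

/-- Steering sends the values of all normalized polynomials towards the same `u`; compactness lets
one `n` serve them all. -/
theorem IsConvexEigenfamily.dense_hittingSet (h : IsConvexEigenfamily T e χ δ)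
    (hpos : Dense (Submodule.span ℂ (e '' Set.Ioo 0 δ) : Set X))
    (hneg : ∀ ε > 0, Dense (Submodule.span ℂ (e '' Set.Ioo (-ε) 0) : Set X))
    {S : Finset (ℕ →₀ ℕ)} {d : ℕ} (hd : 1 ≤ d)
    (hS : ∀ α ∈ S, 1 ≤ α.toMultiset.card ∧ α.toMultiset.card ≤ d) (t : ℕ → ℂ) (N : ℝ)
    {U : Set X} (hU : IsOpen U) (hne : U.Nonempty) :
    Dense (hittingSet T S (normalizedCoeffs S d t N) U) := by
  rw [dense_iff_inter_open]
  intro V hV hVne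
  have hεpos : 0 < δ / d := div_pos h.pos (by positivity)
  obtain ⟨A, hAV, hA⟩ := (dense_pi Set.univ fun (_ : ℕ) _ => hneg (δ / d) hεpos).inter_open_nonempty
    V hV hVne
  obtain ⟨u, huU, hu⟩ := hpos.inter_open_nonempty U hU hne
  obtain ⟨B, hB, hlim⟩ := h.exists_steering_sequence hd hu
  have hfA : Tendsto (fun n i => A i + t i • B n) atTop (𝓝 A) := by
    rw [tendsto_pi_nhds]
    intro i
    simpa using (hB.const_smul (t i)).const_add (A i)
  -- Monomials outside `S` are set to 0, since steering controls only degrees 1 to `d`.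
  have hval : Tendsto (fun n α => if α ∈ S then
        (T ^ n) (α.toMultiset.map fun i => A i + t i • B n).prod else 0) atTop
      (𝓝 fun α : ℕ →₀ ℕ => if α ∈ S then
        (if α.toMultiset.card = d then (α.toMultiset.map t).prod • u else 0) else 0) := by
    rw [tendsto_pi_nhds]
    intro α
    by_cases hα : α ∈ S
    · simp only [if_pos hα]
      exact hlim A t (fun i => hA i (Set.mem_univ i)) α.toMultiset (hS α hα).1 (hS α hα).2
    · simp only [if_neg hα]
      exact tendsto_const_nhds
  have hmem := hval.eventually_mem ((isOpen_setOf_forall_sum_smul_mem S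
    (isCompact_normalizedCoeffs S d t N) hU).mem_nhds ?_)
  · obtain ⟨n, hnV, hn⟩ := ((hfA.eventually_mem (hV.mem_nhds hAV)).and hmem).exists
    refine ⟨_, hnV, n, fun p hp => ?_⟩
    have := hn p hp
    beta_reduce at this
    rwa [Finset.sum_congr rfl fun α hα => by rw [if_pos hα]] at this
  · intro p hp
    have hsum : ∑ α ∈ S, p α • (if α ∈ S then
        (if α.toMultiset.card = d then (α.toMultiset.map t).prod • u else 0) else 0) = u := by
      conv_rhs => rw [← one_smul ℂ u, ← hp.2, Finset.sum_smul]
      refine Finset.sum_congr rfl fun α hα => ?_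
      rw [if_pos hα]
      split_ifs <;> simp [mul_smul]
    rwa [hsum]

variable [SecondCountableTopology X]

theorem IsConvexEigenfamily.eventually_residual_isHypercyclicVector
    (h : IsConvexEigenfamily T e χ δ)
    (hpos : Dense (Submodule.span ℂ (e '' Set.Ioo 0 δ) : Set X))
    (hneg : ∀ ε > 0, Dense (Submodule.span ℂ (e '' Set.Ioo (-ε) 0) : Set X)) :
    ∀ᶠ f in residual (ℕ → X), ∀ P : MvPolynomial ℕ ℂ, P ≠ 0 →
      MvPolynomial.constantCoeff P = 0 → IsHypercyclicVector T (MvPolynomial.aeval f P) := by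
  have hb := TopologicalSpace.isBasis_countableBasis X
  have hall : ∀ᶠ f in residual (ℕ → X), ∀ (S : Finset (ℕ →₀ ℕ)) (d k N : ℕ)
      (U : TopologicalSpace.countableBasis X), 1 ≤ d →
      (∀ α ∈ S, 1 ≤ α.toMultiset.card ∧ α.toMultiset.card ≤ d) →
      f ∈ hittingSet T S
        (normalizedCoeffs S d (TopologicalSpace.denseSeq (ℕ → ℂ) k) N) (U : Set X) := by
    simp only [eventually_countable_forall]
    intro S d k N U hd hS
    have hU := hb.isOpen U.2
    exact residual_of_dense_open
      (isOpen_hittingSet T S (isCompact_normalizedCoeffs _ _ _ _) hU)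
      (h.dense_hittingSet hpos hneg hd hS _ _ hU
        (TopologicalSpace.nonempty_of_mem_countableBasis U.2))
  filter_upwards [hall] with f hf P hP hP0
  set d := P.totalDegree
  -- A polynomial vanishing on a dense set of points is zero, so countably many `t` suffice.
  obtain ⟨k, hk⟩ : ∃ k, MvPolynomial.eval (TopologicalSpace.denseSeq (ℕ → ℂ) k)
      (P.homogeneousComponent d) ≠ 0 := by
    by_contra! hzero
    refine homogeneousComponent_totalDegree_ne_zero hP (MvPolynomial.funext fun x => ?_)
    rw [_root_.map_zero]
    exact congrFun ((MvPolynomial.continuous_eval _).ext_on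
      (TopologicalSpace.denseRange_denseSeq (ℕ → ℂ)) continuous_const
        (by rintro _ ⟨k, rfl⟩; exact hzero k)) x
  set t := TopologicalSpace.denseSeq (ℕ → ℂ) k
  set c := MvPolynomial.eval t (P.homogeneousComponent d) with hc
  have hS : ∀ α ∈ P.support, 1 ≤ α.toMultiset.card ∧ α.toMultiset.card ≤ d := by
    intro α hα
    rw [card_toMultiset_eq_degree]
    refine ⟨Nat.one_le_iff_ne_zero.2 fun hα0 => ?_, MvPolynomial.le_totalDegree hα⟩
    rw [Finsupp.degree_eq_zero_iff] at hα0
    subst hα0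
    exact MvPolynomial.mem_support_iff.1 hα hP0
  obtain ⟨α₀, hα₀⟩ := MvPolynomial.support_nonempty.2 hP
  obtain ⟨N, hN⟩ := exists_nat_ge (∑ α ∈ P.support, ‖c⁻¹ * P.coeff α‖)
  have hp : (fun α => c⁻¹ * P.coeff α) ∈ normalizedCoeffs P.support d t N := by
    refine ⟨fun α => ?_, ?_⟩
    · by_cases hα : α ∈ P.support
      · exact (Finset.single_le_sum (f := fun α => ‖c⁻¹ * P.coeff α‖)
          (fun _ _ => norm_nonneg _) hα).trans hN
      · simp [MvPolynomial.notMem_support_iff.1 hα]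
    · simp_rw [← smul_eq_mul, smul_assoc]
      rw [← Finset.smul_sum, ← eval_homogeneousComponent, ← hc, smul_eq_mul, inv_mul_cancel₀ hk]
  refine IsHypercyclicVector.of_smul (inv_ne_zero hk) (hb.dense_iff.2 fun U hU _ => ?_)
  obtain ⟨n, hn⟩ := hf P.support d k N ⟨U, hU⟩ ((hS α₀ hα₀).1.trans (hS α₀ hα₀).2) hS
  refine ⟨_, hn _ hp, n, ?_⟩
  simp only [aeval_eq_sum_toMultiset, map_smul, map_sum, Finset.smul_sum, mul_smul]

end Baire

/-! ### Free generation and conclusion -/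

/-- In a unital algebra `(z, x) ↦ z + x` is a homomorphism from the unitization, and here `z` is the
vanishing constant term. -/
theorem polyValue_eq_aeval {X : Type*} [CommRing X] [Algebra ℂ X] {ι : Type*} (f : ι → X)
    {P : MvPolynomial ι ℂ} (hP : MvPolynomial.constantCoeff P = 0) :
    polyValue f P = MvPolynomial.aeval f P := by
  let L : Unitization ℂ X →ₐ[ℂ] X := Unitization.lift (NonUnitalAlgHom.id ℂ X)
  have hL : MvPolynomial.aeval f P =
      L (MvPolynomial.aeval (fun i => (f i : Unitization ℂ X)) P) := by
    rw [← AlgHom.comp_apply, MvPolynomial.comp_aeval]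
    simp [L]
  have hLx : ∀ x, L x = algebraMap ℂ X x.fst + x.snd := fun x => rfl
  rw [hL, polyValue, hLx, aeval_unitization_fst, hP, map_zero, zero_add]

theorem exists_polyValue_eq_of_mem_adjoin {X : Type*} [CommRing X] [Algebra ℂ X] {ι : Type*}
    (f : ι → X) {g : X} (hg : g ∈ NonUnitalAlgebra.adjoin ℂ (Set.range f)) :
    ∃ P : MvPolynomial ι ℂ, MvPolynomial.constantCoeff P = 0 ∧ MvPolynomial.aeval f P = g := by
  induction hg using NonUnitalAlgebra.adjoin_induction with
  | mem x hx =>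
    obtain ⟨i, rfl⟩ := hx
    exact ⟨MvPolynomial.X i, by simp, by simp⟩
  | zero => exact ⟨0, by simp, by simp⟩
  | add x y _ _ hx hy =>
    obtain ⟨P, hP, rfl⟩ := hx
    obtain ⟨Q, hQ, rfl⟩ := hy
    exact ⟨P + Q, by simp [hP, hQ], by simp⟩
  | mul x y _ _ hx hy =>
    obtain ⟨P, hP, rfl⟩ := hx
    obtain ⟨Q, hQ, rfl⟩ := hy
    exact ⟨P * Q, by simp [hP], by simp⟩
  | smul c x _ hx =>
    obtain ⟨P, hP, rfl⟩ := hx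
    exact ⟨c • P, by simp [hP], by simp⟩

theorem IsConvexEigenfamily.exists_dense_Gδ_freelyGenerates {X : Type*} [CommRing X] [Algebra ℂ X]
    [TopologicalSpace X] [T2Space X] [Nontrivial X] [IsTopologicalRing X] [ContinuousSMul ℂ X]
    [SecondCountableTopology X] [BaireSpace (ℕ → X)]
    {T : X →L[ℂ] X} {e : ℝ → X} {χ : ℝ → ℂ} {δ : ℝ} (h : IsConvexEigenfamily T e χ δ)
    (hpos : Dense (Submodule.span ℂ (e '' Set.Ioo 0 δ) : Set X))
    (hneg : ∀ ε > 0, Dense (Submodule.span ℂ (e '' Set.Ioo (-ε) 0) : Set X)) :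
    ∃ G : Set (ℕ → X), IsGδ G ∧ Dense G ∧ ∀ f ∈ G,
      ∃ A : NonUnitalSubalgebra ℂ X, FreelyGenerates f A ∧ Dense (A : Set X) ∧
        ∀ g ∈ A, g ≠ 0 → IsHypercyclicVector T g := by
  obtain ⟨G, hG, hGδ, hGd⟩ := mem_residual.1
    ((h.eventually_residual_isHypercyclicVector hpos hneg).and eventually_residual_denseRange)
  refine ⟨G, hGδ, hGd, fun f hf => ⟨NonUnitalAlgebra.adjoin ℂ (Set.range f), ⟨?_, rfl⟩, ?_, ?_⟩⟩
  -- A relation would make 0 hypercyclic, although its orbit `{0}` is closed and `X` is nontrivial.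
  · intro P hP hzero
    by_contra hne
    have hcyc := (hG hf).1 P hne hP
    rw [← polyValue_eq_aeval f hP, hzero] at hcyc
    have hrange : (Set.range fun n : ℕ => (T ^ n) (0 : X)) = {0} := by simp
    rw [IsHypercyclicVector, hrange] at hcyc
    have huniv := hcyc.closure_eq
    rw [closure_singleton] at huniv
    obtain ⟨x, hx⟩ := exists_ne (0 : X)
    exact hx (huniv.symm ▸ Set.mem_univ x : x ∈ ({0} : Set X))
  · exact (hG hf).2.mono (NonUnitalAlgebra.subset_adjoin ℂ)
  · intro g hg hg0
    obtain ⟨P, hP, rfl⟩ := exists_polyValue_eq_of_mem_adjoin f hg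
    exact (hG hf).1 P (by rintro rfl; simp at hg0) hP

theorem accPt_zero_image_ofReal_mul {v : ℂ} (hv : v ≠ 0) {s : Set ℝ}
    (hs : ∃ᶠ x in 𝓝[≠] (0 : ℝ), x ∈ s) :
    AccPt (0 : ℂ) (𝓟 ((fun x : ℝ => (x : ℂ) * v) '' s)) := by
  rw [accPt_iff_frequently_nhdsNE]
  have hlim : Tendsto (fun x : ℝ => (x : ℂ) * v) (𝓝[≠] 0) (𝓝[≠] 0) := by
    refine tendsto_nhdsWithin_iff.2 ⟨?_, ?_⟩
    · have hcont : Continuous fun x : ℝ => (x : ℂ) * v := by fun_prop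
      have := hcont.tendsto 0
      rw [Complex.ofReal_zero, zero_mul] at this
      exact this.mono_left nhdsWithin_le_nhds
    · filter_upwards [self_mem_nhdsWithin] with x hx
      exact mul_ne_zero (Complex.ofReal_ne_zero.2 hx) hv
  exact hlim.frequently (hs.mono fun x hx => ⟨x, hx, rfl⟩)

theorem IsFreeFamily.nontrivial {X : Type*} [NonUnitalCommRing X] [Module ℂ X]
    [IsScalarTower ℂ X X] [SMulCommClass ℂ X X] {ι : Type*} [Nonempty ι] {f : ι → X}
    (hf : IsFreeFamily f) : Nontrivial X := by
  by_contra h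
  rw [not_nontrivial_iff_subsingleton] at h
  obtain ⟨i⟩ := ‹Nonempty ι›
  exact MvPolynomial.X_ne_zero (R := ℂ) i
    (hf (MvPolynomial.X i) (MvPolynomial.constantCoeff_X ℂ i) (Subsingleton.elim _ _))

theorem theorem4p2 {X : Type*} [NonUnitalCommRing X] [Module ℂ X] [IsScalarTower ℂ X X]
    [SMulCommClass ℂ X X]
    -- the topology of `X` is given by a complete translation-invariant metric
    [MetricSpace X] [CompleteSpace X]
    (hinv : ∀ x y z : X, dist (x + z) (y + z) = dist x y)
    -- the algebra operations are continuous
    [IsTopologicalRing X] [ContinuousSMul ℂ X]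
    [TopologicalSpace.SeparableSpace X]
    (hfree : ∃ (S : Set X) (A : NonUnitalSubalgebra ℂ X), S.Nonempty ∧
      FreelyGenerates (fun s : S => (s : X)) A ∧ Dense (A : Set X))
    (T : X →L[ℂ] X) (E : ℂ → X) (φ : ℂ → ℂ) (hφ : Differentiable ℂ φ)
    (ha : ∀ z : ℂ, T (E z) = φ z • E z)
    (hb : ∀ z w : ℂ, E z * E w = E (z + w))
    (hc : ∀ Λ : Set ℂ, (∃ z : ℂ, AccPt z (𝓟 Λ)) →
      Dense (Submodule.span ℂ (E '' Λ) : Set X))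
    (hd₁ : ‖φ 0‖ = 1)
    (hd₂ : iteratedDeriv 2 φ 0 * φ 0 ≠ (deriv φ 0) ^ 2)
    (hd₃ : deriv φ 0 ≠ 0) :
    ∃ G : Set (ℕ → X), IsGδ G ∧ Dense G ∧ ∀ f ∈ G,
      ∃ A : NonUnitalSubalgebra ℂ X, FreelyGenerates f A ∧ Dense (A : Set X) ∧
        ∀ g ∈ A, g ≠ 0 → IsHypercyclicVector T g := by
  obtain ⟨S, _, hSne, ⟨hS, _⟩, _⟩ := hfree
  have : Nonempty S := hSne.to_subtype
  have hnontriv : Nontrivial X := hS.nontrivial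
  have : SecondCountableTopology X := UniformSpace.secondCountable_of_separable X
  have hφ0 : φ 0 ≠ 0 := norm_ne_zero_iff.1 (by rw [hd₁]; exact one_ne_zero)
  obtain ⟨v, hv, δ, hδ, hconv, hmono, hne⟩ := exists_strictConvexOn_log_norm hφ hφ0 hd₂ hd₃
  have hdense : ∀ s : Set ℝ, (∃ᶠ x in 𝓝[≠] (0 : ℝ), x ∈ s) →
      Dense (Submodule.span ℂ ((fun x : ℝ => E (x * v)) '' s) : Set X) := by
    intro s hs
    have := hc _ ⟨0, accPt_zero_image_ofReal_mul hv hs⟩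
    rwa [Set.image_image] at this
  have hpos : Dense (Submodule.span ℂ ((fun x : ℝ => E (x * v)) '' Set.Ioo 0 δ) : Set X) := by
    refine hdense _ (Frequently.filter_mono ?_ (nhdsGT_le_nhdsNE 0))
    exact Eventually.frequently (Ioo_mem_nhdsGT hδ)
  have hneg : ∀ ε > 0,
      Dense (Submodule.span ℂ ((fun x : ℝ => E (x * v)) '' Set.Ioo (-ε) 0) : Set X) := by
    intro ε hε
    refine hdense _ (Frequently.filter_mono ?_ (nhdsLT_le_nhdsNE 0))
    exact Eventually.frequently (Ioo_mem_nhdsLT (neg_lt_zero.2 hε))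
  -- Multiplication by `E 0` is continuous and fixes a dense span.
  have hunit : ∀ x : X, E 0 * x = x := by
    refine fun x => congrFun (Continuous.ext_on hpos (continuous_const_mul (E 0)) continuous_id ?_) x
    intro y hy
    induction hy using Submodule.span_induction with
    | mem y hy =>
      obtain ⟨s, _, rfl⟩ := hy
      simp [hb]
    | zero => simp
    | add y z _ _ hy hz => simpa [mul_add] using congrArg₂ (· + ·) hy hz
    | smul a y _ hy => exact (mul_smul_comm a (E 0) y).trans (congrArg (a • ·) hy)
  -- The ring extends the given non-unital one, so its operations and topology are unchanged.
  let _ : CommRing X :=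
    { ‹NonUnitalCommRing X› with
      one := E 0
      one_mul := hunit
      mul_one := fun x => (mul_comm x (E 0)).trans (hunit x) }
  let _ : Algebra ℂ X := Algebra.ofModule smul_mul_assoc mul_smul_comm
  have hfam : IsConvexEigenfamily T (fun x : ℝ => E (x * v)) (fun x : ℝ => φ (x * v)) δ :=
    { map_zero := by
        simp only [Complex.ofReal_zero, zero_mul]
        rfl
      map_add := fun a b => by
        rw [Complex.ofReal_add, add_mul]
        exact hb _ _
      apply := fun s => ha _
      pos := hδ
      convex := hconv
      mono := hmono
      norm_zero := by simpa using hd₁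
      ne_zero := hne }
  exact hfam.exists_dense_Gδ_freelyGenerates hpos hneg
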